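/- Let $\ell^\infty(\mathbb{N})$, $\mathbb{N}=\{0,1,2,\dots\}$, be the C*-algebra of all bounded sequences $f:\mathbb{N}\to\mathbb{C}$ with the supremum norm, and let $\sigma$ be the shift, $(\sigma f)(n)=f(n+1)$. An anqie is a unital C*-subalgebra $\mathfrak{A}$ of $\ell^\infty(\mathbb{N})$ with $\sigma(\mathfrak{A})\subseteq\mathfrak{A}$; it induces the continuous map $\widehat\sigma:\varphi\mapsto\varphi\circ\sigma$ on its compact Hausdorff space $X_{\mathfrak{A}}$ of maximal ideals (i.e. of unital multiplicative linear functionals $\varphi:\mathfrak{A}\to\mathbb{C}$, with the weak-* topology). The entropy of a bounded sequence $f$ is the topological entropy of $(X_{\mathfrak{A}},\widehat\sigma)$, where $\mathfrak{A}$ is the smallest anqie containing $f$. Here the topological entropy of a continuous self-map $T$ of a compact Hausdorff space $X$ is $$h(T)=\sup_{\mathcal{U}}\ \lim_{n\to\infty}\frac1n\log\mathcal{N}\bigl(\mathcal{U}\vee T^{-1}\mathcal{U}\vee\dots\vee T^{-(n-1)}\mathcal{U}\bigr)\in[0,\infty],$$ the supremum being over all open covers $\mathcal{U}$ of $X$,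 where $\mathcal{U}\vee\mathcal{V}=\{A\cap B: A\in\mathcal{U},\,B\in\mathcal{V}\}$ and $\mathcal{N}(\mathcal{W})$ is the minimal number of members of $\mathcal{W}$ that cover $X$. Let $\{x(n)\}_{n\in\mathbb{N}}$ be a bounded sequence of complex numbers. Then the sequence $\{x(n+1)-x(n)\}_{n\in\mathbb{N}}$ has zero entropy if and only if $\{x(n)\}_{n\in\mathbb{N}}$ has zero entropy. -/

import Mathlib

open scoped BoundedContinuousFunction

namespace SeqEntropy

noncomputable section

/-! ### Topological entropy through open covers -/

section Topological

variable {X : Type*}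

/-- `minCard W` is the minimal number of members of the family `W` needed to cover `X`. -/
def minCard (W : Set (Set X)) : ℕ :=
  sInf {k : ℕ | ∃ F : Finset (Set X), (F : Set (Set X)) ⊆ W ∧ ⋃₀ (F : Set (Set X)) = Set.univ ∧
    F.card = k}

/-- The iterated join `U ∨ T⁻¹ U ∨ ⋯ ∨ T^{-(n-1)} U`: all intersections
`A₀ ∩ T⁻¹ A₁ ∩ ⋯ ∩ T^{-(n-1)} A_{n-1}` with every `Aᵢ ∈ U`. -/
def iterJoin (T : X → X) (U : Set (Set X)) (n : ℕ) : Set (Set X) :=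
  {W | ∃ A : ℕ → Set X, (∀ i < n, A i ∈ U) ∧ W = {x | ∀ i < n, T^[i] x ∈ A i}}

/-- `U` is an open cover of `X`. -/
def IsOpenCover [TopologicalSpace X] (U : Set (Set X)) : Prop :=
  (∀ A ∈ U, IsOpen A) ∧ ⋃₀ U = Set.univ

/-- `h(T, U) = lim_n (1 / n) log N(U ∨ T⁻¹ U ∨ ⋯ ∨ T^{-(n-1)} U)`. For an open cover of a compact
space the limit exists and is finite, see `tendsto_entropyOfCover`. -/
def entropyOfCover (T : X → X) (U : Set (Set X)) : EReal :=
  Filter.limsup (fun n : ℕ => ((Real.log (minCard (iterJoin T U n)) / n : ℝ) : EReal)) Filter.atTop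

/-- The topological entropy of a continuous self-map of a compact space: the supremum
of `h(T, U)` over all open covers `U`, with values in `[0, ∞]` when `X` is not empty. -/
def topEntropy [TopologicalSpace X] [CompactSpace X] (T : C(X, X)) : EReal :=
  ⨆ (U : Set (Set X)) (_ : IsOpenCover U), entropyOfCover T U

theorem iterJoin_isOpenCover [TopologicalSpace X] {T : X → X} (hT : Continuous T)
    {U : Set (Set X)} (hU : IsOpenCover U) (n : ℕ) : IsOpenCover (iterJoin T U n) := by
  refine ⟨?_, Set.eq_univ_of_forall fun x => ?_⟩
  · rintro W ⟨A, hA, rfl⟩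
    have : {x | ∀ i < n, T^[i] x ∈ A i} = ⋂ i ∈ Finset.range n, T^[i] ⁻¹' A i := by
      ext; simp
    rw [this]
    refine isOpen_biInter_finset fun i hi => (hU.1 _ (hA i ?_)).preimage (hT.iterate i)
    simpa using hi
  · have h : ∀ y : X, ∃ A ∈ U, y ∈ A := fun y => by
      have : y ∈ ⋃₀ U := hU.2 ▸ Set.mem_univ y
      simpa using this
    choose B hB hyB using h
    exact ⟨_, ⟨fun i => B (T^[i] x), fun i _ => hB _, rfl⟩, fun i _ => hyB _⟩

theorem minCard_spec [TopologicalSpace X] [CompactSpace X] {U : Set (Set X)} (hU : IsOpenCover U) :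
    ∃ F : Finset (Set X), (F : Set (Set X)) ⊆ U ∧ ⋃₀ (F : Set (Set X)) = Set.univ ∧
      F.card = minCard U := by
  have hne : {k : ℕ | ∃ F : Finset (Set X), (F : Set (Set X)) ⊆ U ∧
      ⋃₀ (F : Set (Set X)) = Set.univ ∧ F.card = k}.Nonempty := by
    obtain ⟨t, htU, hfin, ht⟩ := isCompact_univ.elim_finite_subcover_image
      (b := U) (c := id) hU.1 (by simpa [Set.sUnion_eq_biUnion] using hU.2.ge)
    refine ⟨_, hfin.toFinset, by simpa using htU, ?_, rfl⟩
    rw [hfin.coe_toFinset, Set.sUnion_eq_biUnion]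
    exact Set.univ_subset_iff.1 ht
  exact Nat.sInf_mem hne

theorem minCard_le {U : Set (Set X)} (F : Finset (Set X)) (h₁ : (F : Set (Set X)) ⊆ U)
    (h₂ : ⋃₀ (F : Set (Set X)) = Set.univ) : minCard U ≤ F.card :=
  Nat.sInf_le ⟨F, h₁, h₂, rfl⟩

theorem minCard_iterJoin_add_le [TopologicalSpace X] [CompactSpace X] {T : X → X}
    (hT : Continuous T) {U : Set (Set X)} (hU : IsOpenCover U) (m n : ℕ) :
    minCard (iterJoin T U (m + n)) ≤ minCard (iterJoin T U m) * minCard (iterJoin T U n) := by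
  classical
  obtain ⟨F, hF, hFc, hFk⟩ := minCard_spec (iterJoin_isOpenCover hT hU m)
  obtain ⟨G, hG, hGc, hGk⟩ := minCard_spec (iterJoin_isOpenCover hT hU n)
  let H : Finset (Set X) := (F ×ˢ G).image fun p => p.1 ∩ T^[m] ⁻¹' p.2
  have hH : H.card ≤ F.card * G.card := Finset.card_image_le.trans (Finset.card_product F G).le
  rw [← hFk, ← hGk]
  refine (minCard_le H ?_ ?_).trans hH
  · intro W hW
    obtain ⟨⟨P, Q⟩, hPQ, rfl⟩ := Finset.mem_image.1 (Finset.mem_coe.1 hW)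
    obtain ⟨hP, hQ⟩ := Finset.mem_product.1 hPQ
    obtain ⟨A, hA, rfl⟩ := hF hP
    obtain ⟨B, hB, rfl⟩ := hG hQ
    refine ⟨fun i => if i < m then A i else B (i - m), fun i hi => ?_, ?_⟩
    · by_cases him : i < m
      · simpa [him] using hA i him
      · simpa [him] using hB (i - m) (by omega)
    · ext x
      simp only [Set.mem_inter_iff, Set.mem_ofPred_eq, Set.mem_preimage]
      constructor
      · rintro ⟨h₁, h₂⟩ i hi
        by_cases him : i < m
        · simpa [him] using h₁ i him
        · have := h₂ (i - m) (by omega)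
          rw [← Function.iterate_add_apply, Nat.sub_add_cancel (by omega)] at this
          simpa [him] using this
      · intro h
        refine ⟨fun i hi => ?_, fun i hi => ?_⟩
        · simpa [hi] using h i (by omega)
        · have := h (i + m) (by omega)
          rw [Function.iterate_add_apply] at this
          simpa using this
  · refine Set.eq_univ_of_forall fun x => ?_
    obtain ⟨P, hP, hxP⟩ : x ∈ ⋃₀ (F : Set (Set X)) := hFc ▸ Set.mem_univ x
    obtain ⟨Q, hQ, hxQ⟩ : T^[m] x ∈ ⋃₀ (G : Set (Set X)) := hGc ▸ Set.mem_univ _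
    exact ⟨_, Finset.mem_coe.2 (Finset.mem_image.2
      ⟨(P, Q), Finset.mem_product.2 ⟨hP, hQ⟩, rfl⟩), hxP, hxQ⟩

/-- The limit superior in `entropyOfCover` is a limit. -/
theorem tendsto_entropyOfCover [TopologicalSpace X] [CompactSpace X] {T : X → X}
    (hT : Continuous T) {U : Set (Set X)} (hU : IsOpenCover U) :
    Filter.Tendsto (fun n : ℕ => ((Real.log (minCard (iterJoin T U n)) / n : ℝ) : EReal))
      Filter.atTop (nhds (entropyOfCover T U)) := by
  have hsub : Subadditive fun n => Real.log (minCard (iterJoin T U n)) := by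
    intro m n
    have hle := minCard_iterJoin_add_le hT hU m n
    rcases Nat.eq_zero_or_pos (minCard (iterJoin T U (m + n))) with h0 | hpos
    · simp only [h0, Nat.cast_zero, Real.log_zero]
      exact add_nonneg (Real.log_natCast_nonneg _) (Real.log_natCast_nonneg _)
    · have hmn : minCard (iterJoin T U m) ≠ 0 ∧ minCard (iterJoin T U n) ≠ 0 :=
        mul_ne_zero_iff.1 (by omega)
      dsimp only
      rw [← Real.log_mul (by exact_mod_cast hmn.1) (by exact_mod_cast hmn.2)]
      exact Real.log_le_log (by exact_mod_cast hpos) (by exact_mod_cast hle)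
  have hlim := hsub.tendsto_lim ⟨0, by
    rintro _ ⟨n, rfl⟩
    exact div_nonneg (Real.log_natCast_nonneg _) (Nat.cast_nonneg _)⟩
  have hE := (continuous_coe_real_ereal.tendsto hsub.lim).comp hlim
  have heq : entropyOfCover T U = (hsub.lim : EReal) := hE.limsup_eq
  rw [heq]
  exact hE

end Topological

/-! ### Anqies and the entropy of a bounded sequence -/

/-- `ℓ^∞(ℕ)`, the unital C*-algebra of all bounded functions `ℕ → ℂ` with pointwise operations
and the supremum norm (`ℕ` is discrete, so continuity is automatic). -/
abbrev EllInfty : Type := ℕ →ᵇ ℂ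

/-- The shift `(σ f)(n) = f(n + 1)` on `ℓ^∞(ℕ)`, as a unital *-homomorphism. -/
def shift : EllInfty →⋆ₐ[ℂ] EllInfty where
  toFun f := f.compContinuous ⟨fun n : ℕ => n + 1, continuous_of_discreteTopology⟩
  map_one' := rfl
  map_mul' _ _ := rfl
  map_zero' := rfl
  map_add' _ _ := rfl
  commutes' _ := rfl
  map_star' _ := rfl

@[simp] theorem shift_apply (f : EllInfty) (n : ℕ) : shift f n = f (n + 1) := rfl

/-- An anqie: a unital C*-subalgebra of `ℓ^∞(ℕ)`, i.e. a norm-closed unital *-subalgebra, that is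
mapped into itself by the shift. -/
structure Anqie extends StarSubalgebra ℂ EllInfty where
  isClosed' : IsClosed carrier
  shift_mem' : ∀ f ∈ carrier, shift f ∈ carrier

namespace Anqie

variable (A : Anqie)

instance : CompleteSpace A.toStarSubalgebra :=
  (show IsClosed (A.toStarSubalgebra : Set EllInfty) from A.isClosed').completeSpace_coe

/-- The space of maximal ideals of `A`: the unital multiplicative functionals `A → ℂ` with the
weak-* topology. -/
abbrev Spec : Type := WeakDual.characterSpace ℂ A.toStarSubalgebra

/-- The shift, restricted to the anqie `A`. -/
def shiftHom : A.toStarSubalgebra →⋆ₐ[ℂ] A.toStarSubalgebra :=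
  (shift.comp A.toStarSubalgebra.subtype).codRestrict A.toStarSubalgebra
    fun f => A.shift_mem' f f.2

/-- The continuous self-map of the space of maximal ideals that the shift induces, `φ ↦ φ ∘ σ`. -/
def specMap : C(A.Spec, A.Spec) :=
  WeakDual.CharacterSpace.compContinuousMap A.shiftHom

/-- The entropy of an anqie: the topological entropy of the dynamical system it induces. -/
def entropy : EReal := topEntropy A.specMap

/-- The anqie generated by `f`: the smallest anqie containing `f`. -/
def generate (f : EllInfty) : Anqie where
  toStarSubalgebra := sInf {S : StarSubalgebra ℂ EllInfty |
    IsClosed (S : Set EllInfty) ∧ (∀ g ∈ S, shift g ∈ S) ∧ f ∈ S}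
  isClosed' := by
    change IsClosed ((sInf _ : StarSubalgebra ℂ EllInfty) : Set EllInfty)
    rw [StarSubalgebra.coe_sInf]
    exact isClosed_biInter fun S hS => hS.1
  shift_mem' g hg := by
    change g ∈ (sInf _ : StarSubalgebra ℂ EllInfty) at hg
    change shift g ∈ (sInf _ : StarSubalgebra ℂ EllInfty)
    rw [StarSubalgebra.mem_sInf] at hg ⊢
    exact fun S hS => hS.2.1 g (hg S hS)

end Anqie

/-- The (anqie) entropy of a bounded sequence: the entropy of the anqie it generates. -/
def seqEntropy (f : EllInfty) : EReal := (Anqie.generate f).entropy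

end

end SeqEntropy

/-! Zero entropy of `x` is a statement about blocks: `HasZeroWordEntropy` asks that all length-`n`
blocks be uniformly approximable by `exp (o(n))` words. `seqEntropy_eq_zero_iff` rests on two facts
about the spectrum of `generate x`: evaluations at integers are dense (`exists_evalSpec_near`), and
a character is determined by its values on the shifts of `x` (`spec_ext`). The spectrum is thus the
orbit closure of `x` in a product of copies of `ℂ`.

For blocks, passing from `x` to its differences is Lipschitz. Conversely, `x` is recovered by
summing approximate differences from anchors placed every `m` steps. With `N` net points available
at each anchor, the anchors cost about `log N / m` per unit length. `N` depends only on the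
precision and the bound on `x`, so a large `m` makes this cost negligible. -/

namespace SeqEntropy

/-! ### Open covers, subexponential growth and Lebesgue numbers -/

section Covers

variable {X : Type*}

theorem minCard_le_of_refines {U V : Set (Set X)} (h : ∀ B ∈ V, ∃ A ∈ U, B ⊆ A)
    (F : Finset (Set X)) (hF : (F : Set (Set X)) ⊆ V) (hcov : ⋃₀ (F : Set (Set X)) = Set.univ) :
    minCard U ≤ F.card := by
  classical
  choose! g hgU hg using h
  refine (minCard_le (F.image g) ?_ ?_).trans Finset.card_image_le
  · intro W hW
    obtain ⟨B, hB, rfl⟩ := Finset.mem_image.1 (Finset.mem_coe.1 hW)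
    exact hgU B (hF hB)
  · refine Set.eq_univ_of_forall fun x => ?_
    obtain ⟨B, hB, hx⟩ : x ∈ ⋃₀ (F : Set (Set X)) := hcov ▸ Set.mem_univ x
    exact ⟨g B, Finset.mem_coe.2 (Finset.mem_image_of_mem g hB), hg B (hF hB) hx⟩

theorem isOpenCover_singleton_univ [TopologicalSpace X] : IsOpenCover ({Set.univ} : Set (Set X)) :=
  ⟨by simp, by simp⟩

theorem entropyOfCover_nonneg (T : X → X) (U : Set (Set X)) : 0 ≤ entropyOfCover T U := by
  refine Filter.le_limsup_of_frequently_le (Filter.Frequently.of_forall fun n => ?_)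
  exact_mod_cast div_nonneg (Real.log_natCast_nonneg _) (Nat.cast_nonneg _)

/-- Vanishing of the topological entropy says that the iterated joins of every open cover have
subcovers of subexponential cardinality. -/
theorem topEntropy_eq_zero_iff [TopologicalSpace X] [CompactSpace X] (T : C(X, X)) :
    topEntropy T = 0 ↔ ∀ U : Set (Set X), IsOpenCover U → ∀ η : ℝ, 0 < η →
      ∀ᶠ n : ℕ in Filter.atTop, (minCard (iterJoin T U n) : ℝ) ≤ Real.exp (η * n) := by
  constructor
  · intro h U hU η hη
    have hle : entropyOfCover T U ≤ 0 :=
      h ▸ le_iSup₂ (f := fun (U : Set (Set X)) (_ : IsOpenCover U) => entropyOfCover T U) U hU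
    have hlt : entropyOfCover T U < (η : EReal) := hle.trans_lt (by exact_mod_cast hη)
    filter_upwards [(tendsto_entropyOfCover T.continuous hU).eventually_lt_const hlt,
      Filter.eventually_gt_atTop 0] with n hn hn0
    have hn' : Real.log (minCard (iterJoin T U n)) / n < η := by exact_mod_cast hn
    rw [div_lt_iff₀ (by exact_mod_cast hn0)] at hn'
    rcases Nat.eq_zero_or_pos (minCard (iterJoin T U n)) with h0 | hpos
    · rw [h0]; simpa using (Real.exp_pos _).le
    · exact (Real.log_le_iff_le_exp (by exact_mod_cast hpos)).1 hn'.le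
  · intro h
    refine le_antisymm (iSup₂_le fun U hU => ?_) ((entropyOfCover_nonneg T _).trans
      (le_iSup₂ (f := fun (U : Set (Set X)) (_ : IsOpenCover U) => entropyOfCover T U) _
        isOpenCover_singleton_univ))
    refine EReal.le_of_forall_lt_iff_le.1 fun η hη => ?_
    have hη' : 0 < η := by exact_mod_cast hη
    refine Filter.limsup_le_of_le (h := ?_)
    filter_upwards [h U hU η hη', Filter.eventually_gt_atTop 0] with n hn hn0
    have hn0' : (0 : ℝ) < n := by exact_mod_cast hn0
    have : Real.log (minCard (iterJoin T U n)) / n ≤ η := by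
      rw [div_le_iff₀ hn0']
      rcases Nat.eq_zero_or_pos (minCard (iterJoin T U n)) with h0 | hpos
      · rw [h0]; simpa using by positivity
      · exact (Real.log_le_iff_le_exp (by exact_mod_cast hpos)).2 hn
    exact_mod_cast this

/-- A sequence of continuous functions that separates the points of a compact space controls its
topology. -/
theorem exists_forall_dist_lt_imp_mem [TopologicalSpace X] [CompactSpace X] {f : ℕ → X → ℂ}
    (hf : ∀ k, Continuous (f k)) (hsep : ∀ p q, (∀ k, f k p = f k q) → p = q)
    {A : Set X} (hA : IsOpen A) {p : X} (hp : p ∈ A) :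
    ∃ K : ℕ, ∀ q, (∀ k < K, dist (f k q) (f k p) < 2 / (K + 1 : ℝ)) → q ∈ A := by
  have hF : Continuous fun (q : X) (k : ℕ) => f k q := continuous_pi hf
  -- A continuous injection of a compact space into a Hausdorff one is an embedding, so
  -- neighbourhoods in `X` come from the product.
  have hind := (hF.isClosedEmbedding fun p q h => hsep p q fun k => congrFun h k).isInducing
  have hA' := hA.mem_nhds hp
  rw [hind.nhds_eq_comap, Filter.mem_comap] at hA'
  obtain ⟨V, hV, hVA⟩ := hA'
  rw [nhds_pi, Filter.mem_pi] at hV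
  obtain ⟨I, hI, t, ht, htV⟩ := hV
  choose ε hε hεt using fun i => Metric.mem_nhds_iff.1 (ht i)
  have hlim : Filter.Tendsto (fun K : ℕ => 2 / (K + 1 : ℝ)) Filter.atTop (nhds 0) := by
    simpa [div_eq_mul_inv] using (tendsto_one_div_add_atTop_nhds_zero_nat (𝕜 := ℝ)).const_mul 2
  have hev : ∀ᶠ K : ℕ in Filter.atTop, ∀ i ∈ I, i < K ∧ 2 / (K + 1 : ℝ) < ε i :=
    (Filter.eventually_all_finite hI).2 fun i _ =>
      (Filter.eventually_gt_atTop i).and (hlim.eventually_lt_const (hε i))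
  obtain ⟨K, hK⟩ := hev.exists
  exact ⟨K, fun q hq => hVA (htV fun i hi => hεt i ((hq i (hK i hi).1).trans (hK i hi).2))⟩

/-- A Lebesgue number for an open cover, relative to a separating sequence of functions. -/
theorem exists_lebesgue_number [TopologicalSpace X] [CompactSpace X] {f : ℕ → X → ℂ}
    (hf : ∀ k, Continuous (f k)) (hsep : ∀ p q, (∀ k, f k p = f k q) → p = q)
    {U : Set (Set X)} (hU : IsOpenCover U) :
    ∃ (K : ℕ) (ε : ℝ), 0 < ε ∧
      ∀ p, ∃ A ∈ U, ∀ q, (∀ k < K, dist (f k q) (f k p) < ε) → q ∈ A := by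
  have h : ∀ p : X, ∃ A ∈ U, ∃ K : ℕ,
      ∀ q, (∀ k < K, dist (f k q) (f k p) < 2 / (K + 1 : ℝ)) → q ∈ A := fun p => by
    obtain ⟨A, hA, hp⟩ : p ∈ ⋃₀ U := hU.2 ▸ Set.mem_univ p
    exact ⟨A, hA, exists_forall_dist_lt_imp_mem hf hsep (hU.1 A hA) hp⟩
  choose A hAU K hK using h
  -- Half the radius `2 / (K p + 1)`: the other half is left for the distance from `q` to `p` in the
  -- triangle inequality.
  let B : X → Set X := fun p => ⋂ k ∈ Finset.range (K p), {q | dist (f k q) (f k p) < 1 / (K p + 1)}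
  have hBo : ∀ p, IsOpen (B p) := fun p => isOpen_biInter_finset fun k _ =>
    isOpen_lt ((hf k).dist continuous_const) continuous_const
  have hBp : ∀ p, p ∈ B p := fun p => by
    simp only [B, Set.mem_iInter, Set.mem_ofPred_eq, dist_self]
    intros; positivity
  obtain ⟨t, ht⟩ := isCompact_univ.elim_finite_subcover B hBo
    fun p _ => Set.mem_iUnion.2 ⟨p, hBp p⟩
  refine ⟨t.sup K, 1 / (t.sup K + 1), by positivity, fun p => ?_⟩
  obtain ⟨c, hc, hpc⟩ := Set.mem_iUnion₂.1 (ht (Set.mem_univ p))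
  refine ⟨A c, hAU c, fun q hq => hK c q fun k hk => ?_⟩
  have hle : K c ≤ t.sup K := Finset.le_sup hc
  have h₁ := hq k (hk.trans_le hle)
  have h₂ : dist (f k p) (f k c) < 1 / (K c + 1) := by
    simp only [B, Set.mem_iInter, Finset.mem_range] at hpc
    exact hpc k hk
  have h₃ : (1 : ℝ) / ((t.sup K : ℕ) + 1) ≤ 1 / (K c + 1) := by
    gcongr
  calc dist (f k q) (f k c) ≤ dist (f k q) (f k p) + dist (f k p) (f k c) := dist_triangle _ _ _
    _ < 1 / (K c + 1) + 1 / (K c + 1) := add_lt_add (h₁.trans_le h₃) h₂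
    _ = 2 / (K c + 1) := by ring

end Covers

/-! ### Characters of an anqie -/

/-- A bounded sequence that stays away from zero is invertible in `ℓ^∞`. -/
theorem isUnit_of_le_norm {f : EllInfty} {δ : ℝ} (hδ : 0 < δ)
    (hf : ∀ j, δ ≤ ‖f j‖) : IsUnit f := by
  have h0 : ∀ j, f j ≠ 0 := fun j => norm_pos_iff.1 (hδ.trans_le (hf j))
  let g : EllInfty := BoundedContinuousFunction.ofNormedAddCommGroup (fun j => (f j)⁻¹)
    continuous_of_discreteTopology δ⁻¹ fun j => by
      rw [norm_inv]; exact inv_anti₀ hδ (hf j)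
  exact IsUnit.of_mul_eq_one g (by ext j; exact mul_inv_cancel₀ (h0 j))

namespace Anqie

variable (A : Anqie)

/-- Evaluation at a point, as a character of an anqie. -/
noncomputable def evalSpec (j : ℕ) : A.Spec :=
  WeakDual.CharacterSpace.equivAlgHom.symm
    ({ toFun := fun g => (g : EllInfty) j
       map_one' := rfl
       map_mul' := fun _ _ => rfl
       map_zero' := rfl
       map_add' := fun _ _ => rfl
       commutes' := fun _ => rfl } : A.toStarSubalgebra →ₐ[ℂ] ℂ)

@[simp] theorem evalSpec_apply (j : ℕ) (g : A.toStarSubalgebra) :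
    A.evalSpec j g = (g : EllInfty) j := rfl

@[simp] theorem coe_shiftHom (g : A.toStarSubalgebra) :
    (A.shiftHom g : EllInfty) = shift (g : EllInfty) := rfl

theorem specMap_iterate_apply (k : ℕ) (φ : A.Spec) (g : A.toStarSubalgebra) :
    A.specMap^[k] φ g = φ (A.shiftHom^[k] g) := by
  induction k generalizing φ with
  | zero => rfl
  | succ k ih => rw [Function.iterate_succ_apply, ih, Function.iterate_succ_apply']; rfl

theorem shiftHom_iterate_apply (k : ℕ) (g : A.toStarSubalgebra) (j : ℕ) :
    ((A.shiftHom^[k] g : A.toStarSubalgebra) : EllInfty) j = (g : EllInfty) (j + k) := by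
  induction k generalizing j with
  | zero => rfl
  | succ k ih =>
    rw [Function.iterate_succ_apply', coe_shiftHom, shift_apply, ih]
    congr 1; omega

theorem continuous_eval (g : A.toStarSubalgebra) : Continuous fun φ : A.Spec => φ g :=
  map_continuous (WeakDual.gelfandTransform ℂ A.toStarSubalgebra g)

/-- The evaluations are dense in the space of maximal ideals. -/
theorem exists_evalSpec_near (φ : A.Spec) {ι : Type*} (s : Finset ι) (g : ι → A.toStarSubalgebra)
    {ε : ℝ} (hε : 0 < ε) : ∃ j : ℕ, ∀ i ∈ s, ‖φ (g i) - (g i : EllInfty) j‖ < ε := by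
  by_contra! hcon
  -- If no evaluation is near `φ`, then `∑ |g i - φ (g i)|²` is at least `ε²` on `ℕ`, hence
  -- invertible in `ℓ^∞` and, by spectral permanence, in `A`; yet `φ` kills it.
  let u : ι → A.toStarSubalgebra := fun i => g i - algebraMap ℂ _ (φ (g i))
  let f : A.toStarSubalgebra := ∑ i ∈ s, star (u i) * u i
  have hφu : ∀ i, φ (u i) = 0 := fun i => by
    have : φ (algebraMap ℂ A.toStarSubalgebra (φ (g i))) = φ (g i) := AlgHomClass.commutes φ _
    simp only [u, map_sub, this, sub_self]
  have hφf : φ f = 0 := by simp [f, map_sum, map_mul, hφu]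
  have hval : ∀ j, (f : EllInfty) j = ((∑ i ∈ s, ‖φ (g i) - (g i : EllInfty) j‖ ^ 2 : ℝ) : ℂ) := by
    intro j
    have h1 : A.evalSpec j f = ∑ i ∈ s, A.evalSpec j (star (u i) * u i) := map_sum _ _ _
    rw [evalSpec_apply] at h1
    rw [h1, Complex.ofReal_sum]
    refine Finset.sum_congr rfl fun i _ => ?_
    rw [norm_sub_rev, Complex.ofReal_pow, ← Complex.conj_mul']
    rfl
  have hunit : IsUnit (f : EllInfty) := by
    refine isUnit_of_le_norm (sq_pos_of_pos hε) fun j => ?_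
    obtain ⟨i, hi, hij⟩ := hcon j
    rw [hval, Complex.norm_real, Real.norm_of_nonneg (by positivity)]
    calc ε ^ 2 ≤ ‖φ (g i) - (g i : EllInfty) j‖ ^ 2 := by gcongr
      _ ≤ _ := Finset.single_le_sum (f := fun i => ‖φ (g i) - (g i : EllInfty) j‖ ^ 2)
        (fun _ _ => by positivity) hi
  have : IsClosed (A.toStarSubalgebra : Set EllInfty) := A.isClosed'
  have := (A.toStarSubalgebra.coe_isUnit.1 hunit).map φ
  rw [hφf] at this
  exact not_isUnit_zero this

theorem mem_generate (x : EllInfty) : x ∈ (generate x).toStarSubalgebra :=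
  StarSubalgebra.mem_sInf.2 fun _ hS => hS.2.2

theorem generate_le {x : EllInfty} {S : StarSubalgebra ℂ EllInfty}
    (hc : IsClosed (S : Set EllInfty))
    (hs : ∀ g ∈ S, shift g ∈ S) (hx : x ∈ S) : (generate x).toStarSubalgebra ≤ S :=
  sInf_le ⟨hc, hs, hx⟩

/-- The generating sequence, as an element of the anqie it generates. -/
def gen (x : EllInfty) : (generate x).toStarSubalgebra := ⟨x, mem_generate x⟩

/-- The values on the shifts of the generator determine a character. -/
theorem spec_ext {x : EllInfty} {φ ψ : (generate x).Spec}
    (h : ∀ k, (generate x).specMap^[k] φ (gen x) = (generate x).specMap^[k] ψ (gen x)) :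
    φ = ψ := by
  let A := generate x
  let R : A.Spec → A.Spec → Prop := fun φ ψ =>
    ∀ k, A.specMap^[k] φ (gen x) = A.specMap^[k] ψ (gen x)
  -- Quantifying over all `R`-related pairs makes `S` shift-invariant, because `specMap` preserves
  -- `R`.
  let S : StarSubalgebra ℂ A.toStarSubalgebra :=
    { carrier := {g | ∀ φ ψ, R φ ψ → φ g = ψ g}
      mul_mem' := fun ha hb φ ψ h => by rw [map_mul, map_mul, ha φ ψ h, hb φ ψ h]
      add_mem' := fun ha hb φ ψ h => by rw [map_add, map_add, ha φ ψ h, hb φ ψ h]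
      algebraMap_mem' := fun c φ ψ _ => by rw [AlgHomClass.commutes, AlgHomClass.commutes]
      star_mem' := fun ha φ ψ h => by
        have : IsClosed (A.toStarSubalgebra : Set EllInfty) := A.isClosed'
        rw [map_star, map_star, ha φ ψ h] }
  have hS : IsClosed (S : Set A.toStarSubalgebra) := by
    have : (S : Set A.toStarSubalgebra) =
        ⋂ (φ : A.Spec) (ψ : A.Spec) (_ : R φ ψ), {g | φ g = ψ g} := by
      ext g
      simp only [Set.mem_iInter]
      rfl
    rw [this]
    exact isClosed_iInter fun φ => isClosed_iInter fun ψ => isClosed_iInter fun _ =>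
      isClosed_eq (map_continuous φ) (map_continuous ψ)
  have hle : A.toStarSubalgebra ≤ S.map A.toStarSubalgebra.subtype := by
    refine generate_le ?_ ?_ ⟨gen x, fun φ ψ h => h 0, rfl⟩
    · rw [StarSubalgebra.coe_map]
      exact (show IsClosed (A.toStarSubalgebra : Set EllInfty) from
        A.isClosed').isClosedEmbedding_subtypeVal.isClosedMap _ hS
    · rintro _ ⟨g, hg, rfl⟩
      exact ⟨A.shiftHom g, fun φ ψ h => hg (A.specMap φ) (A.specMap ψ) fun k => h (k + 1), rfl⟩
  refine WeakDual.CharacterSpace.ext fun g => ?_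
  obtain ⟨g', hg', hgg'⟩ := hle g.2
  obtain rfl : g' = g := Subtype.ext hgg'
  exact hg' φ ψ h

end Anqie

/-! ### Zero entropy in terms of words -/

/-- For all `ε, η > 0` and all large `n`, at most `exp (η n)` words suffice to approximate every
block of length `n` of the sequence within `ε`. -/
def HasZeroWordEntropy (x : ℕ → ℂ) : Prop :=
  ∀ ε : ℝ, 0 < ε → ∀ η : ℝ, 0 < η → ∀ᶠ n : ℕ in Filter.atTop, ∃ F : Finset (ℕ → ℂ),
    (F.card : ℝ) ≤ Real.exp (η * n) ∧ ∀ j, ∃ w ∈ F, ∀ k < n, ‖x (j + k) - w k‖ < ε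

open Anqie in
-- Cover the spectrum by the sets where the value at the generator lies in a given `ε`-disk. A
-- member of the iterated join carries the word of its disk centres, and the characters `evalSpec j`
-- turn this into a word for the block of `x` at `j`.
theorem hasZeroWordEntropy_of_seqEntropy_eq_zero {x : EllInfty} (h : seqEntropy x = 0) :
    HasZeroWordEntropy x := by
  classical
  intro ε hε η hη
  let A := generate x
  let U : Set (Set A.Spec) := Set.range fun c : ℂ => {φ | ‖φ (gen x) - c‖ < ε}
  have hU : IsOpenCover U := by
    refine ⟨?_, Set.eq_univ_of_forall fun φ => ⟨_, ⟨φ (gen x), rfl⟩, by simpa using hε⟩⟩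
    rintro _ ⟨c, rfl⟩
    exact isOpen_lt ((A.continuous_eval (gen x)).sub continuous_const).norm continuous_const
  filter_upwards [(topEntropy_eq_zero_iff A.specMap).1 h U hU η hη] with n hn
  obtain ⟨F, hFU, hFcov, hFcard⟩ := minCard_spec
    (iterJoin_isOpenCover A.specMap.continuous hU n)
  have hw : ∀ W ∈ iterJoin A.specMap U n, ∃ w : ℕ → ℂ,
      ∀ φ ∈ W, ∀ k < n, ‖A.specMap^[k] φ (gen x) - w k‖ < ε := by
    rintro _ ⟨B, hB, rfl⟩
    choose! w hw using hB
    refine ⟨w, fun φ hφ k hk => ?_⟩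
    have h1 : A.specMap^[k] φ ∈ B k := hφ k hk
    rw [← hw k hk] at h1
    exact h1
  choose! w hw using hw
  refine ⟨F.image w, ?_, fun j => ?_⟩
  · refine le_trans ?_ hn
    rw [← hFcard]
    exact_mod_cast Finset.card_image_le
  · obtain ⟨W, hW, hj⟩ : A.evalSpec j ∈ ⋃₀ (F : Set (Set A.Spec)) := hFcov ▸ Set.mem_univ _
    refine ⟨w W, Finset.mem_image_of_mem w hW, fun k hk => ?_⟩
    have h1 := hw W (hFU hW) _ hj k hk
    rwa [specMap_iterate_apply, evalSpec_apply, shiftHom_iterate_apply] at h1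

open Anqie in
theorem seqEntropy_eq_zero_of_hasZeroWordEntropy {x : EllInfty} (h : HasZeroWordEntropy x) :
    seqEntropy x = 0 := by
  classical
  let A := generate x
  refine (topEntropy_eq_zero_iff A.specMap).2 fun U hU η hη => ?_
  obtain ⟨K, ε, hε, hK⟩ := exists_lebesgue_number
    (f := fun k (φ : A.Spec) => A.specMap^[k] φ (gen x))
    (fun k => (A.continuous_eval (gen x)).comp (A.specMap.continuous.iterate k))
    (fun _ _ h => spec_ext h) hU
  -- Density and word approximation each cost `ε / 4`, so two characters sharing a word are within
  -- `ε`. Words have length `n + K`, since the Lebesgue number inspects `K` iterates; `η / 2`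
  -- absorbs this once `K ≤ n`.
  have hev := h (ε / 4) (by positivity) (η / 2) (by positivity)
  filter_upwards [(Filter.tendsto_add_atTop_nat K).eventually hev,
    Filter.eventually_ge_atTop K] with n hn hKn
  obtain ⟨F, hFcard, hF⟩ := hn
  let C : (ℕ → ℂ) → Set A.Spec := fun w =>
    {φ | ∀ k < n + K, ‖A.specMap^[k] φ (gen x) - w k‖ < ε / 2}
  have hcov : ⋃₀ ((F.image C : Finset (Set A.Spec)) : Set (Set A.Spec)) = Set.univ := by
    refine Set.eq_univ_of_forall fun φ => ?_
    obtain ⟨j, hj⟩ := A.exists_evalSpec_near φ (Finset.range (n + K))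
      (fun k => A.shiftHom^[k] (gen x)) (ε := ε / 4) (by positivity)
    obtain ⟨w, hwF, hw⟩ := hF j
    refine ⟨C w, Finset.mem_coe.2 (Finset.mem_image_of_mem C hwF), fun k hk => ?_⟩
    have h1 := hj k (Finset.mem_range.2 hk)
    have h2 : ‖x (j + k) - w k‖ < ε / 4 := hw k hk
    rw [shiftHom_iterate_apply] at h1
    rw [specMap_iterate_apply]
    calc ‖φ (A.shiftHom^[k] (gen x)) - w k‖
        ≤ ‖φ (A.shiftHom^[k] (gen x)) - x (j + k)‖ + ‖x (j + k) - w k‖ :=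
          norm_sub_le_norm_sub_add_norm_sub _ _ _
      _ < ε / 4 + ε / 4 := add_lt_add h1 h2
      _ = ε / 2 := by ring
  have href : ∀ B ∈ ((F.image C : Finset (Set A.Spec)) : Set (Set A.Spec)),
      ∃ W ∈ iterJoin A.specMap U n, B ⊆ W := by
    intro B hB
    obtain ⟨w, -, rfl⟩ := Finset.mem_image.1 (Finset.mem_coe.1 hB)
    choose L hLU hL using hK
    rcases (C w).eq_empty_or_nonempty with he | ⟨p, hp⟩
    · exact ⟨_, ⟨fun i => L (A.specMap^[i] (A.evalSpec 0)), fun i _ => hLU _, rfl⟩,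
        he ▸ Set.empty_subset _⟩
    · refine ⟨_, ⟨fun i => L (A.specMap^[i] p), fun i _ => hLU _, rfl⟩, fun q hq i hi => ?_⟩
      refine hL _ _ fun k hk => ?_
      rw [← Function.iterate_add_apply, ← Function.iterate_add_apply]
      have h1 := hq (k + i) (by omega)
      have h2 := hp (k + i) (by omega)
      calc _ ≤ _ := dist_triangle_right _ _ (w (k + i))
        _ < ε / 2 + ε / 2 := by rw [dist_eq_norm, dist_eq_norm]; exact add_lt_add h1 h2
        _ = ε := by ring
  have hle := (minCard_le_of_refines href _ subset_rfl hcov).trans Finset.card_image_le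
  calc (minCard (iterJoin A.specMap U n) : ℝ) ≤ F.card := by exact_mod_cast hle
    _ ≤ Real.exp (η / 2 * (n + K : ℕ)) := hFcard
    _ ≤ Real.exp (η * n) := by
      have : (K : ℝ) ≤ n := by exact_mod_cast hKn
      rw [Real.exp_le_exp]; push_cast; nlinarith

theorem seqEntropy_eq_zero_iff (x : EllInfty) : seqEntropy x = 0 ↔ HasZeroWordEntropy x :=
  ⟨hasZeroWordEntropy_of_seqEntropy_eq_zero, seqEntropy_eq_zero_of_hasZeroWordEntropy⟩

/-! ### Differences and summation -/

theorem HasZeroWordEntropy.sub_succ {x : ℕ → ℂ} (h : HasZeroWordEntropy x) :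
    HasZeroWordEntropy fun n => x (n + 1) - x n := by
  classical
  intro ε hε η hη
  -- A block of `n` differences needs `n + 1 ≤ 2 * n` values, hence `η / 2`.
  filter_upwards [(Filter.tendsto_add_atTop_nat 1).eventually
    (h (ε / 2) (by positivity) (η / 2) (by positivity)), Filter.eventually_ge_atTop 1] with n hn hn1
  obtain ⟨F, hFcard, hF⟩ := hn
  refine ⟨F.image fun w k => w (k + 1) - w k, ?_, fun j => ?_⟩
  · calc (((F.image fun w k => w (k + 1) - w k).card : ℕ) : ℝ) ≤ F.card := by
          exact_mod_cast Finset.card_image_le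
      _ ≤ _ := hFcard
      _ ≤ Real.exp (η * n) := by
        have : (1 : ℝ) ≤ n := by exact_mod_cast hn1
        rw [Real.exp_le_exp]; push_cast; nlinarith
  · obtain ⟨w, hwF, hw⟩ := hF j
    refine ⟨_, Finset.mem_image_of_mem _ hwF, fun k hk => ?_⟩
    have h1 := hw (k + 1) (by omega)
    have h2 := hw k (by omega)
    calc ‖x (j + k + 1) - x (j + k) - (w (k + 1) - w k)‖
        = ‖(x (j + (k + 1)) - w (k + 1)) - (x (j + k) - w k)‖ := by
          rw [← add_assoc]; congr 1; ring
      _ ≤ _ := norm_sub_le _ _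
      _ < ε / 2 + ε / 2 := add_lt_add h1 h2
      _ = ε := by ring

/-- A bounded sequence is determined, up to a small error, by approximations of its differences
and by approximations of its values along an arithmetic progression, whose difference is as large
as desired. -/
theorem HasZeroWordEntropy.of_sub_succ {x : ℕ → ℂ} {R : ℝ} (hR : ∀ n, ‖x n‖ ≤ R)
    (h : HasZeroWordEntropy fun n => x (n + 1) - x n) : HasZeroWordEntropy x := by
  classical
  intro ε hε η hη
  obtain ⟨t, -, htfin, ht⟩ := Metric.finite_approx_of_totallyBounded
    (isCompact_closedBall (0 : ℂ) R).totallyBounded (ε / 2) (by positivity)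
  have hnet : ∀ n, ∃ c : htfin.toFinset, ‖x n - c‖ < ε / 2 := fun n => by
    obtain ⟨c, hc, hxc⟩ := Set.mem_iUnion₂.1 (ht (mem_closedBall_zero_iff.2 (hR n)))
    exact ⟨⟨c, htfin.mem_toFinset.2 hc⟩, by simpa [dist_eq_norm] using hxc⟩
  choose a ha using hnet
  set N : ℕ := htfin.toFinset.card
  have hN0 : (0 : ℝ) < N := by exact_mod_cast Finset.card_pos.2 ⟨_, (a 0).2⟩
  have hlogN : 0 ≤ Real.log N := Real.log_natCast_nonneg N
  -- The spacing `m` gives `log N < m * η / 3`.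
  obtain ⟨m, hm⟩ := exists_nat_gt (3 * Real.log N / η)
  have hm0 : (0 : ℝ) < m := (by positivity : 0 ≤ 3 * Real.log N / η).trans_lt hm
  have hm0' : 0 < m := by exact_mod_cast hm0
  rw [div_lt_iff₀ hη] at hm
  -- Fewer than `m` differences are summed after an anchor, for a total error of at most `ε / 2`.
  -- The exponent `η` splits into thirds: the words of `F`, the factor `N ^ (n / m)`, and the extra
  -- `N`, absorbed since `m ≤ n`.
  filter_upwards [h (ε / 2 / m) (by positivity) (η / 3) (by positivity),
    Filter.eventually_ge_atTop m] with n hn hmn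
  obtain ⟨F, hFcard, hF⟩ := hn
  have hmn' : (m : ℝ) ≤ n := by exact_mod_cast hmn
  -- Last anchor before `k`, plus the approximate differences since. `Fin.ofNat` does not wrap
  -- around for `k < n`.
  let word : (ℕ → ℂ) × (Fin (n / m + 1) → htfin.toFinset) → ℕ → ℂ := fun p k =>
    p.2 (Fin.ofNat _ (k / m)) + ∑ s ∈ Finset.range (k % m), p.1 (m * (k / m) + s)
  refine ⟨(F ×ˢ Finset.univ).image word, ?_, fun j => ?_⟩
  · have hle : ((F ×ˢ Finset.univ).image word).card ≤ F.card * N ^ (n / m + 1) := by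
      refine Finset.card_image_le.trans (le_of_eq ?_)
      rw [Finset.card_product, Finset.card_univ, Fintype.card_fun, Fintype.card_coe,
        Fintype.card_fin]
    have hpow : (N : ℝ) ^ (n / m + 1) ≤ Real.exp (η / 3 * n + η / 3 * n) := by
      rw [← Real.exp_log hN0, ← Real.exp_nat_mul, Real.exp_le_exp]
      have h1 : ((n / m : ℕ) : ℝ) * m ≤ n := by exact_mod_cast Nat.div_mul_le_self n m
      have h2 : ((n / m : ℕ) : ℝ) * Real.log N ≤ η / 3 * n := by
        have : ((n / m : ℕ) : ℝ) * Real.log N ≤ ((n / m : ℕ) : ℝ) * (m * η / 3) := by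
          gcongr; linarith
        nlinarith
      push_cast
      nlinarith
    calc ((((F ×ˢ Finset.univ).image word).card : ℕ) : ℝ) ≤ F.card * (N : ℝ) ^ (n / m + 1) := by
          exact_mod_cast hle
      _ ≤ Real.exp (η / 3 * n) * Real.exp (η / 3 * n + η / 3 * n) := by gcongr
      _ = Real.exp (η * n) := by rw [← Real.exp_add]; congr 1; ring
  · obtain ⟨w, hwF, hw⟩ := hF j
    refine ⟨word (w, fun b => a (j + m * b)), Finset.mem_image_of_mem word
      (Finset.mem_product.2 ⟨hwF, Finset.mem_univ _⟩), fun k hk => ?_⟩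
    have hb : ((Fin.ofNat (n / m + 1) (k / m) : Fin _) : ℕ) = k / m :=
      Nat.mod_eq_of_lt (Nat.lt_succ_of_le (Nat.div_le_div_right hk.le))
    have hkm := Nat.div_add_mod k m
    have htel := Finset.sum_range_sub (fun s => x (j + m * (k / m) + s)) (k % m)
    have hx : x (j + k) = x (j + m * (k / m)) + ∑ s ∈ Finset.range (k % m),
        (x (j + (m * (k / m) + s) + 1) - x (j + (m * (k / m) + s))) := by
      simp only [← add_assoc] at htel ⊢
      rw [htel, add_assoc j, hkm]
      simp
    have hsum : ‖∑ s ∈ Finset.range (k % m), ((x (j + (m * (k / m) + s) + 1)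
        - x (j + (m * (k / m) + s))) - w (m * (k / m) + s))‖ ≤ ε / 2 := by
      calc _ ≤ ∑ s ∈ Finset.range (k % m), ε / 2 / m := by
            refine norm_sum_le_of_le _ fun s hs => (hw _ ?_).le
            have := Finset.mem_range.1 hs
            omega
        _ = (k % m : ℕ) * (ε / 2 / m) := by simp
        _ ≤ m * (ε / 2 / m) := by
            gcongr
            exact (Nat.mod_lt k hm0').le
        _ = ε / 2 := by field_simp
    calc ‖x (j + k) - word (w, fun b => a (j + m * b)) k‖
        = ‖(x (j + m * (k / m)) - a (j + m * (k / m))) + ∑ s ∈ Finset.range (k % m),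
          ((x (j + (m * (k / m) + s) + 1) - x (j + (m * (k / m) + s)))
            - w (m * (k / m) + s))‖ := by
          simp only [word, hb]
          rw [hx]
          simp only [Finset.sum_sub_distrib]
          congr 1; ring
      _ ≤ _ := norm_add_le _ _
      _ < ε / 2 + ε / 2 := add_lt_add_of_lt_of_le (ha _) hsum
      _ = ε := by ring

end SeqEntropy
theorem corollary2 (x : ℕ →ᵇ ℂ) :
    SeqEntropy.seqEntropy (SeqEntropy.shift x - x) = 0 ↔ SeqEntropy.seqEntropy x = 0 := by
  rw [SeqEntropy.seqEntropy_eq_zero_iff, SeqEntropy.seqEntropy_eq_zero_iff]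
  exact ⟨fun h => .of_sub_succ x.norm_coe_le_norm h, fun h => h.sub_succ⟩
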